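/- **Setting.** Let $0<B_L\le B_U$, $B_U\le M<\infty$ and $Q>3B_U$. Let $Y_0,Y_1,Y_2,\dots$ be i.i.d. random transmission delays with $\Pr(Y_j\in[B_L,B_U])=1$, and let $g:[0,\infty)\to[0,\infty)$ be continuous and nondecreasing. Update $0$, with delay $Y_0$, is delivered at time $D_0=0$, so it was requested at $R_0=-Y_0$. For $j\ge 0$, after the delivery of update $j$ at time $D_j$ the destination waits for a time $Z_j\in[0,M]$, requests update $j+1$ at $R_{j+1}=D_j+Z_j$ and receives it at $D_{j+1}=R_{j+1}+Y_{j+1}$. A causal update policy chooses $Z_j$ as a measurable function of $Y_0,\dots,Y_j$ and, possibly, of a randomization independent of the delays. The age of information at time $t$ is $\Delta(t)=t-\sup\{R_j: D_j\le t\}$, and the optimal expected age penalty of the delay process $Y=(Y_j)_{j\ge0}$ at the query time $Q$ is $$h(Y)=\inf_{\pi} E\big[g(\Delta(Q))\big],$$ the infimum being over all causal update policies with waiting periods in $[0,M]$. For a positive integer $N$ let $$Y_j^{\mathrm{upp},N}=\frac QN\left\lceil\frac{Y_j}{Q/N}\right\rceil,\qquad Y_j^{\mathrm{low},N}=\frac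 QN\left\lfloor\frac{Y_j}{Q/N}\right\rfloor$$ be the upper and the lower quantized transmission delay processes; their optimal expected age penalties $h(Y^{\mathrm{upp},N})$ and $h(Y^{\mathrm{low},N})$ are defined in the same way, with policies that observe the quantized delays. **Proposition.** For every $\varepsilon>0$ there is $N_1\in\mathbb N$ such that for all $N\ge N_1$ $$\big|h(Y^{\mathrm{upp},N})-h(Y^{\mathrm{low},N})\big|<\varepsilon .$$ Moreover, $N_1$ can be chosen so that for all $N\ge N_1$ also $\big|h(Y^{\mathrm{upp},N})-h(Y)\big|<\varepsilon$ and $\big|h(Y^{\mathrm{low},N})-h(Y)\big|<\varepsilon$: both quantized optima approximate the true optimum arbitrarily well. -/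

import Mathlib

open MeasureTheory ProbabilityTheory

noncomputable section

namespace PullOrWait

/-- A causal update policy with waiting periods in `[0, M]`.  The waiting period that follows the
delivery of update `j` is a measurable function of the delays `Y₀, …, Y_j` observed so far and of
a random seed, independent of the delays, which makes room for randomized policies. (Earlier
waiting periods are themselves functions of the same data.) -/
structure UpdatePolicy (M : ℝ) where
  wait : (j : ℕ) → (Fin (j + 1) → ℝ) → (ℕ → unitInterval) → ℝ
  measurable_wait : ∀ j : ℕ,
    Measurable (fun p : (Fin (j + 1) → ℝ) × (ℕ → unitInterval) => wait j p.1 p.2)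
  wait_mem : ∀ (j : ℕ) (y : Fin (j + 1) → ℝ) (u : ℕ → unitInterval), wait j y u ∈ Set.Icc 0 M

/-- The law of the random seed: a sequence of independent uniform variables on `[0, 1]`. -/
def seedLaw : Measure (ℕ → unitInterval) :=
  Measure.infinitePi (fun _ : ℕ => (volume : Measure unitInterval))

variable {M : ℝ}

/-- The waiting period `Z_j` for the delay sequence `y` and the seed `u`. -/
def waiting (π : UpdatePolicy M) (y : ℕ → ℝ) (u : ℕ → unitInterval) (j : ℕ) : ℝ :=
  π.wait j (fun i => y i) u

/-- The delivery times: `D₀ = 0` and `D_{j+1} = D_j + Z_j + Y_{j+1}`. -/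
def delivery (π : UpdatePolicy M) (y : ℕ → ℝ) (u : ℕ → unitInterval) : ℕ → ℝ
  | 0 => 0
  | j + 1 => delivery π y u j + waiting π y u j + y (j + 1)

/-- The request times: `R_{j+1} = D_j + Z_j`; update `0` was requested at `R₀ = D₀ - Y₀ = -Y₀`. -/
def request (π : UpdatePolicy M) (y : ℕ → ℝ) (u : ℕ → unitInterval) : ℕ → ℝ
  | 0 => - y 0
  | j + 1 => delivery π y u j + waiting π y u j

/-- The age of information `Δ(t) = t - U(t)`, with `U(t)` the latest request time among the
updates delivered by time `t`. -/
def age (π : UpdatePolicy M) (y : ℕ → ℝ) (u : ℕ → unitInterval) (t : ℝ) : ℝ :=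
  t - sSup {r : ℝ | ∃ j : ℕ, delivery π y u j ≤ t ∧ r = request π y u j}

/-- The expected age penalty `E[g(Δ(Q))]` at the query `Q` under the policy `π`, when the
transmission delay process is `Y`. -/
def expectedPenalty {Ω : Type*} [MeasurableSpace Ω] (P : Measure Ω) (Y : ℕ → Ω → ℝ)
    (g : ℝ → ℝ) (Q : ℝ) (π : UpdatePolicy M) : ℝ :=
  ∫ p : Ω × (ℕ → unitInterval), g (age π (fun j => Y j p.1) p.2 Q) ∂(P.prod seedLaw)

/-- The optimal expected age penalty of the single query problem: the infimum over all causal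
update policies. -/
def optimalPenalty {Ω : Type*} [MeasurableSpace Ω] (P : Measure Ω) (Y : ℕ → Ω → ℝ)
    (g : ℝ → ℝ) (M Q : ℝ) : ℝ :=
  ⨅ π : UpdatePolicy M, expectedPenalty P Y g Q π

/-- The upper quantization of a delay process, with step `Q / N`. -/
def upperQuantized {Ω : Type*} (Q : ℝ) (N : ℕ) (Y : ℕ → Ω → ℝ) : ℕ → Ω → ℝ :=
  fun j ω => Q / N * (⌈Y j ω / (Q / N)⌉ : ℝ)

/-- The lower quantization of a delay process, with step `Q / N`. -/
def lowerQuantized {Ω : Type*} (Q : ℝ) (N : ℕ) (Y : ℕ → Ω → ℝ) : ℕ → Ω → ℝ :=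
  fun j ω => Q / N * (⌊Y j ω / (Q / N)⌋ : ℝ)

end PullOrWait

end

/-! The three optima are linked in a cycle of one-sided inequalities, each losing at most `ε / 4`:
low ≤ true ≤ upper ≤ low for a query advanced by `δ` ≤ low.

The first three links are simulations (`lawPenalty_fst_le`). A system that sees delays `b` samples
close delays `a` from their conditional law given `b`, feeds them to a policy `π` for `a`, and
copies the waiting periods of `π`. All delays of the simulated system are at least `c > 0`, so at
most `Q / c` of its updates matter and the timing errors add up to at most `(Q / c + 1) * q`, where
`q` is the quantization step. If `b ≤ a`, deliveries are never late and the age grows only by this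
error. The link from upper to low goes the wrong way: deliveries may slip past the query. Hence the
simulated query is placed `δ` earlier, with `δ` at least the accumulated error. Uniform continuity
of `g` on the bounded range of ages turns age errors into penalty errors.

The last link (`lawPenalty_sub_le`) says that an earlier query is no harder. This is not obvious,
since `π` may request update `1` before time `δ`, which cannot be moved back by `δ`. That update is
then replaced by an imaginary one with a sampled delay. Every update that remains in use is shifted
by `δ`, and the i.i.d. assumption guarantees that `π` still sees delays of the right law. -/

namespace PullOrWait

/-! ### Policies given by adapted rules -/

/-- Extend a finite history by zeros. -/
def extendHistory {j : ℕ} (f : Fin (j + 1) → ℝ) (i : ℕ) : ℝ :=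
  if h : i < j + 1 then f ⟨i, h⟩ else 0

lemma measurable_extendHistory {j : ℕ} :
    Measurable (extendHistory : (Fin (j + 1) → ℝ) → ℕ → ℝ) := by
  refine measurable_pi_iff.2 fun i => ?_
  unfold extendHistory
  split_ifs with h
  · exact measurable_pi_apply _
  · exact measurable_const

/-- The policy that waits according to a rule `W`, truncated to `[0, M]`, where the rule sees the
history of delays and the randomization `θ u`. -/
noncomputable def UpdatePolicy.ofRule {M : ℝ} (hM : 0 ≤ M) {S : Type*} [MeasurableSpace S]
    (W : ℕ → (ℕ → ℝ) → S → ℝ)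
    (hW : ∀ j, Measurable (fun p : (ℕ → ℝ) × S => W j p.1 p.2))
    (θ : (ℕ → unitInterval) → S) (hθ : Measurable θ) : UpdatePolicy M where
  wait j f u := max 0 (min M (W j (extendHistory f) (θ u)))
  measurable_wait j := by
    refine measurable_const.max (measurable_const.min ?_)
    exact (hW j).comp
      ((measurable_extendHistory.comp measurable_fst).prodMk (hθ.comp measurable_snd))
  wait_mem j f u := ⟨le_max_left _ _, max_le hM (min_le_left _ _)⟩

/-- A rule is adapted if the waiting period after update `j` only depends on the delays of the
updates `0, …, j`. -/
def AdaptedRule {S : Type*} (W : ℕ → (ℕ → ℝ) → S → ℝ) : Prop :=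
  ∀ j y y' s, (∀ i ≤ j, y i = y' i) → W j y s = W j y' s

variable {M : ℝ}

lemma waiting_ofRule (hM : 0 ≤ M) {S : Type*} [MeasurableSpace S]
    {W : ℕ → (ℕ → ℝ) → S → ℝ} (hW : ∀ j, Measurable (fun p : (ℕ → ℝ) × S => W j p.1 p.2))
    {θ : (ℕ → unitInterval) → S} (hθ : Measurable θ) (hadapt : AdaptedRule W)
    (y : ℕ → ℝ) (u : ℕ → unitInterval) (j : ℕ) :
    waiting (UpdatePolicy.ofRule hM W hW θ hθ) y u j = max 0 (min M (W j y (θ u))) := by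
  have h := hadapt j (extendHistory (fun i : Fin (j + 1) => y i)) y (θ u) (fun i hi => by
    simp [extendHistory, Nat.lt_succ_of_le hi])
  simp [waiting, UpdatePolicy.ofRule, h]

lemma waiting_congr (π : UpdatePolicy M) {y y' : ℕ → ℝ} (u : ℕ → unitInterval) {j : ℕ}
    (h : ∀ i ≤ j, y i = y' i) : waiting π y u j = waiting π y' u j := by
  unfold waiting
  congr 1
  funext i
  exact h i (Nat.lt_succ_iff.1 i.2)

lemma waiting_mem (π : UpdatePolicy M) (y : ℕ → ℝ) (u : ℕ → unitInterval) (j : ℕ) :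
    waiting π y u j ∈ Set.Icc 0 M := π.wait_mem _ _ _

/-! ### Measurability -/

lemma measurable_waiting (π : UpdatePolicy M) (j : ℕ) :
    Measurable (fun p : (ℕ → ℝ) × (ℕ → unitInterval) => waiting π p.1 p.2 j) := by
  refine (π.measurable_wait j).comp (Measurable.prodMk ?_ measurable_snd)
  exact measurable_pi_iff.2 fun i => (measurable_pi_apply _).comp measurable_fst

lemma measurable_delivery (π : UpdatePolicy M) (j : ℕ) :
    Measurable (fun p : (ℕ → ℝ) × (ℕ → unitInterval) => delivery π p.1 p.2 j) := by
  induction j with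
  | zero => exact measurable_const
  | succ j ih =>
    exact (ih.add (measurable_waiting π j)).add ((measurable_pi_apply _).comp measurable_fst)

lemma measurable_request (π : UpdatePolicy M) (j : ℕ) :
    Measurable (fun p : (ℕ → ℝ) × (ℕ → unitInterval) => request π p.1 p.2 j) := by
  cases j with
  | zero => exact ((measurable_pi_apply 0).comp measurable_fst).neg
  | succ j => exact (measurable_delivery π j).add (measurable_waiting π j)

/-- The supremum over delivered updates becomes a countable supremum of measurable functions once
undelivered ones are replaced by update `0`, which is always delivered by a time `t ≥ 0`. -/
lemma measurable_age (π : UpdatePolicy M) {t : ℝ} (ht : 0 ≤ t) :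
    Measurable (fun p : (ℕ → ℝ) × (ℕ → unitInterval) => age π p.1 p.2 t) := by
  have h : ∀ p : (ℕ → ℝ) × (ℕ → unitInterval), age π p.1 p.2 t =
      t - ⨆ j, if delivery π p.1 p.2 j ≤ t then request π p.1 p.2 j
        else request π p.1 p.2 0 := by
    intro p
    unfold age
    congr 2
    ext r
    constructor
    · rintro ⟨j, hj, rfl⟩
      exact ⟨j, if_pos hj⟩
    · rintro ⟨j, rfl⟩
      by_cases hj : delivery π p.1 p.2 j ≤ t
      · exact ⟨j, hj, if_pos hj⟩
      · exact ⟨0, ht, if_neg hj⟩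
  simp_rw [h]
  refine measurable_const.sub (Measurable.iSup fun j => ?_)
  exact Measurable.ite (measurableSet_le (measurable_delivery π j) measurable_const)
    (measurable_request π j) (measurable_request π 0)

/-! ### Elementary properties of the age -/

lemma request_le_delivery (π : UpdatePolicy M) {y : ℕ → ℝ} (hy : ∀ j, 0 ≤ y j)
    (u : ℕ → unitInterval) (j : ℕ) : request π y u j ≤ delivery π y u j := by
  cases j with
  | zero => simpa [request, delivery] using hy 0
  | succ j => simpa [request, delivery] using hy (j + 1)

lemma mul_le_delivery (π : UpdatePolicy M) {y : ℕ → ℝ} {c : ℝ} (hy : ∀ j, c ≤ y j)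
    (u : ℕ → unitInterval) (j : ℕ) : j * c ≤ delivery π y u j := by
  induction j with
  | zero => simp [delivery]
  | succ j ih =>
    have := (waiting_mem π y u j).1
    have := hy (j + 1)
    simp only [delivery]
    push_cast
    linarith

lemma bddAbove_requests (π : UpdatePolicy M) {y : ℕ → ℝ} (hy : ∀ j, 0 ≤ y j)
    (u : ℕ → unitInterval) (t : ℝ) :
    BddAbove {r : ℝ | ∃ j : ℕ, delivery π y u j ≤ t ∧ r = request π y u j} :=
  ⟨t, by rintro _ ⟨j, hj, rfl⟩; exact (request_le_delivery π hy u j).trans hj⟩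

lemma age_le_sub_request (π : UpdatePolicy M) {y : ℕ → ℝ} (hy : ∀ j, 0 ≤ y j)
    (u : ℕ → unitInterval) {t : ℝ} {j : ℕ} (hj : delivery π y u j ≤ t) :
    age π y u t ≤ t - request π y u j :=
  sub_le_sub_left (le_csSup (bddAbove_requests π hy u t) ⟨j, hj, rfl⟩) _

lemma le_age_of_forall (π : UpdatePolicy M) {y : ℕ → ℝ} {u : ℕ → unitInterval} {t : ℝ}
    (ht : 0 ≤ t) {x : ℝ} (h : ∀ j, delivery π y u j ≤ t → x ≤ t - request π y u j) :
    x ≤ age π y u t := by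
  unfold age
  rw [le_sub_comm]
  refine csSup_le ⟨_, 0, ht, rfl⟩ ?_
  rintro _ ⟨j, hj, rfl⟩
  exact le_sub_comm.1 (h j hj)

lemma age_nonneg (π : UpdatePolicy M) {y : ℕ → ℝ} (hy : ∀ j, 0 ≤ y j)
    (u : ℕ → unitInterval) {t : ℝ} (ht : 0 ≤ t) : 0 ≤ age π y u t :=
  le_age_of_forall π ht fun j hj => sub_nonneg.2 ((request_le_delivery π hy u j).trans hj)

lemma age_le_add (π : UpdatePolicy M) {y : ℕ → ℝ} (hy : ∀ j, 0 ≤ y j)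
    (u : ℕ → unitInterval) {t : ℝ} (ht : 0 ≤ t) : age π y u t ≤ t + y 0 := by
  simpa [request] using age_le_sub_request π hy u (j := 0) ht

/-- If every update delivered by time `t` in the first system has a counterpart in the second one
which is delivered by time `t'` and is at most `η` older then, then the age at `t'` in the second
system exceeds the age at `t` in the first one by at most `η`. -/
lemma age_le_age_add (π π' : UpdatePolicy M) {y y' : ℕ → ℝ} (hy' : ∀ j, 0 ≤ y' j)
    {u u' : ℕ → unitInterval} {t t' η : ℝ} (ht : 0 ≤ t)
    (h : ∀ j, delivery π y u j ≤ t → ∃ k, delivery π' y' u' k ≤ t' ∧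
      t' - request π' y' u' k ≤ t - request π y u j + η) :
    age π' y' u' t' ≤ age π y u t + η := by
  rw [← sub_le_iff_le_add]
  refine le_age_of_forall π ht fun j hj => ?_
  obtain ⟨k, hk, hkj⟩ := h j hj
  linarith [age_le_sub_request π' hy' u' hk]

/-! ### Sequences of independent variables -/

/-- A product measure is determined by its finite marginals, where this is the usual regrouping of a
finite product. It attaches an independent uniform variable to each delay. -/
lemma map_zip_infinitePi {ι α β : Type*} [MeasurableSpace α] [MeasurableSpace β]
    (μ : Measure α) (ν : Measure β) [IsProbabilityMeasure μ] [IsProbabilityMeasure ν] :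
    ((Measure.infinitePi fun _ : ι => μ).prod (Measure.infinitePi fun _ : ι => ν)).map
      (fun p i => (p.1 i, p.2 i)) = Measure.infinitePi fun _ : ι => μ.prod ν := by
  refine (Measure.isProjectiveLimit_infinitePi (fun _ : ι => μ.prod ν)).unique ?_ |>.symm
  intro I
  have h := (measurePreserving_arrowProdEquivProdArrow α β I (fun _ => μ) (fun _ => ν)).symm
  change _ = Measure.pi fun _ : I => μ.prod ν
  rw [← h.map_eq, ← Measure.infinitePi_map_restrict (fun _ : ι => μ),
    ← Measure.infinitePi_map_restrict (fun _ : ι => ν),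
    Measure.map_prod_map _ _ (by fun_prop) (by fun_prop),
    Measure.map_map (by fun_prop) (by fun_prop), Measure.map_map (by fun_prop) (by fun_prop)]
  rfl

/-- Prepend a term to a sequence. -/
def consSeq {α : Type*} (p : α × (ℕ → α)) : ℕ → α
  | 0 => p.1
  | n + 1 => p.2 n

lemma measurable_consSeq {α : Type*} [MeasurableSpace α] :
    Measurable (consSeq : α × (ℕ → α) → ℕ → α) := by
  refine measurable_pi_iff.2 fun i => ?_
  cases i with
  | zero => exact measurable_fst
  | succ n => exact (measurable_pi_apply n).comp measurable_snd

lemma measurePreserving_consSeq {α : Type*} [MeasurableSpace α] (μ : Measure α)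
    [IsProbabilityMeasure μ] :
    MeasurePreserving consSeq (μ.prod (Measure.infinitePi fun _ : ℕ => μ))
      (Measure.infinitePi fun _ : ℕ => μ) := by
  refine ⟨measurable_consSeq, Measure.eq_infinitePi _ fun s t ht => ?_⟩
  rw [Measure.map_apply measurable_consSeq (.pi s.countable_toSet fun i _ => ht i)]
  classical
  -- The preimage of a box is a box: coordinate `0` constrains the prepended term, if it occurs in
  -- `s`, and the others constrain the tail with indices lowered by one.
  have h : consSeq ⁻¹' ((s : Set ℕ).pi t) =
      (if 0 ∈ s then t 0 else Set.univ) ×ˢ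
        (((s.erase 0).image Nat.pred : Finset ℕ) : Set ℕ).pi (fun n => t (n + 1)) := by
    ext p
    simp only [Set.mem_preimage, Set.mem_pi, Set.mem_prod, Finset.mem_coe, Finset.mem_image,
      Finset.mem_erase]
    constructor
    · intro hp
      refine ⟨?_, ?_⟩
      · split_ifs with h0
        · exact hp 0 h0
        · trivial
      · rintro _ ⟨i, ⟨hi0, hi⟩, rfl⟩
        obtain ⟨k, rfl⟩ := Nat.exists_eq_succ_of_ne_zero hi0
        exact hp _ hi
    · rintro ⟨h0, hp⟩ i hi
      cases i with
      | zero => rw [if_pos hi] at h0; exact h0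
      | succ n => exact hp n ⟨n + 1, ⟨by simp, hi⟩, rfl⟩
  rw [h, Measure.prod_prod, Measure.infinitePi_pi _ fun i _ => ht _, Finset.prod_image]
  · have h2 : ∏ x ∈ s.erase 0, μ (t (x.pred + 1)) = ∏ x ∈ s.erase 0, μ (t x) := by
      refine Finset.prod_congr rfl fun x hx => ?_
      rw [Nat.pred_eq_sub_one, Nat.sub_add_cancel (Nat.pos_of_ne_zero (Finset.ne_of_mem_erase hx))]
    rw [h2]
    split_ifs with h0
    · exact Finset.mul_prod_erase s (fun x => μ (t x)) h0
    · simp [Finset.erase_eq_of_notMem h0]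
  · intro a ha b hb hab
    simp only [Finset.coe_erase, Set.mem_sdiff, Set.mem_singleton_iff] at ha hb
    have := ha.2
    have := hb.2
    simp only [Nat.pred_eq_sub_one] at hab
    omega

lemma map_succ_infinitePi {α : Type*} [MeasurableSpace α] (μ : Measure α)
    [IsProbabilityMeasure μ] :
    (Measure.infinitePi fun _ : ℕ => μ).map (fun x n => x (n + 1)) =
      Measure.infinitePi fun _ : ℕ => μ :=
  Measure.map_infinitePi_infinitePi_of_inj (P := fun _ : ℕ => μ) (add_left_injective 1)

lemma ae_forall_of_infinitePi {α : Type*} [MeasurableSpace α] {μ : Measure α}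
    [IsProbabilityMeasure μ] {p : α → Prop} (h : ∀ᵐ x ∂μ, p x) :
    ∀ᵐ x ∂(Measure.infinitePi fun _ : ℕ => μ), ∀ n, p (x n) :=
  ae_all_iff.2 fun n =>
    (measurePreserving_eval_infinitePi (fun _ : ℕ => μ) n).quasiMeasurePreserving.ae h

/-! ### Randomization -/

instance : IsProbabilityMeasure seedLaw := by unfold seedLaw; infer_instance

/-- Every law on a standard Borel space can be sampled from the seed. -/
lemma exists_measurePreserving_seedLaw {S : Type*} [MeasurableSpace S] [StandardBorelSpace S]
    [Nonempty S] (ρ : Measure S) [IsProbabilityMeasure ρ] :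
    ∃ θ : (ℕ → unitInterval) → S, MeasurePreserving θ seedLaw ρ := by
  obtain ⟨f, hf, hfρ⟩ := Measure.exists_measurable_map_eq ρ
  exact ⟨_, (MeasurePreserving.mk hf hfρ).comp
    (measurePreserving_eval_infinitePi (fun _ : ℕ => (volume : Measure unitInterval)) 0)⟩

/-- The second component of a pair can be sampled from the first one and an independent uniform
variable. -/
lemma exists_sampling {α β : Type*} [MeasurableSpace α] [MeasurableSpace β]
    [StandardBorelSpace β] [Nonempty β] (κ : Measure (α × β)) [IsProbabilityMeasure κ] :
    ∃ φ : α → unitInterval → β, Measurable (Function.uncurry φ) ∧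
      (κ.fst.prod volume).map (fun p => (p.1, φ p.1 p.2)) = κ := by
  -- Each conditional law of the second component is the image of the uniform law under `φ a`,
  -- jointly measurably in `a`.
  obtain ⟨φ, hφ, h⟩ := Kernel.exists_measurable_map_eq_unitInterval κ.condKernel
  refine ⟨φ, hφ, ?_⟩
  have hm : Measurable fun p : α × unitInterval => (p.1, φ p.1 p.2) :=
    measurable_fst.prodMk hφ
  conv_rhs => rw [← κ.disintegrate κ.condKernel]
  ext s hs
  rw [Measure.map_apply hm hs, Measure.prod_apply (hm hs), Measure.compProd_apply hs]
  refine lintegral_congr fun a => ?_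
  rw [← h a, Measure.map_apply (f := φ a) (hφ.comp measurable_prodMk_left) (measurable_prodMk_left hs)]
  rfl

/-! ### Expected penalties on the canonical space -/

/-- The optimal expected penalty for i.i.d. delays with law `μ`. -/
noncomputable def lawPenalty (μ : Measure ℝ) (g : ℝ → ℝ) (M Q : ℝ) : ℝ :=
  optimalPenalty (Measure.infinitePi fun _ : ℕ => μ) (fun j y => y j) g M Q

/-- The penalty depends on the delay process only through its law, so couplings may be built on the
canonical space. -/
lemma expectedPenalty_eq_of_iIndepFun {Ω : Type*} [MeasurableSpace Ω] {P : Measure Ω}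
    [IsProbabilityMeasure P] {Y : ℕ → Ω → ℝ} (hY : ∀ j, Measurable (Y j)) (hind : iIndepFun Y P)
    {μ : Measure ℝ} (hμ : ∀ j, P.map (Y j) = μ) {g : ℝ → ℝ} (hg : Measurable g) {Q : ℝ}
    (hQ : 0 ≤ Q) (π : UpdatePolicy M) :
    expectedPenalty P Y g Q π =
      expectedPenalty (Measure.infinitePi fun _ : ℕ => μ) (fun j y => y j) g Q π := by
  have h : P.map (fun ω j => Y j ω) = Measure.infinitePi fun _ : ℕ => μ := by
    rw [(iIndepFun_iff_map_fun_eq_infinitePi_map hY).1 hind]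
    simp_rw [hμ]
  have hYm : Measurable fun ω j => Y j ω := measurable_pi_iff.2 hY
  unfold expectedPenalty
  have h2 : (Measure.infinitePi fun _ : ℕ => μ).prod seedLaw =
      (P.prod seedLaw).map (Prod.map (fun ω j => Y j ω) id) := by
    rw [← h, ← Measure.map_prod_map _ _ hYm measurable_id, Measure.map_id]
  rw [h2, integral_map (by fun_prop)]
  · rfl
  · exact (hg.comp (measurable_age π hQ)).aestronglyMeasurable

lemma nonempty_updatePolicy (hM : 0 ≤ M) : Nonempty (UpdatePolicy M) :=
  ⟨⟨fun _ _ _ => 0, fun _ => measurable_const, fun _ _ _ => ⟨le_rfl, hM⟩⟩⟩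

/-- Transfer principle behind all comparisons: `Θ` turns the data of the `μ'` system into data with
the law that `π` expects, so a pathwise comparison of ages integrates to a comparison of penalties.
As `π` is arbitrary, no optimal policy is needed. -/
lemma lawPenalty_le_add (hM : 0 ≤ M) {μ μ' : Measure ℝ} [IsProbabilityMeasure μ]
    [IsProbabilityMeasure μ'] {g : ℝ → ℝ} (hg : Continuous g) (hmono : Monotone g)
    (hnonneg : ∀ x, 0 ≤ g x) {Q Q' η ε K C : ℝ} (hQ : 0 ≤ Q)
    (hμ : ∀ᵐ x ∂μ, x ∈ Set.Icc 0 C) (hK : Q + C ≤ K)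
    (hη : ∀ x ∈ Set.Icc 0 K, g (x + η) ≤ g x + ε)
    (h : ∀ π : UpdatePolicy M, ∃ (π' : UpdatePolicy M)
      (Θ : (ℕ → ℝ) × (ℕ → unitInterval) → (ℕ → ℝ) × (ℕ → unitInterval)),
      MeasurePreserving Θ ((Measure.infinitePi fun _ : ℕ => μ').prod seedLaw)
        ((Measure.infinitePi fun _ : ℕ => μ).prod seedLaw) ∧
      ∀ᵐ p ∂((Measure.infinitePi fun _ : ℕ => μ').prod seedLaw),
        age π' p.1 p.2 Q' ≤ age π (Θ p).1 (Θ p).2 Q + η) :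
    lawPenalty μ' g M Q' ≤ lawPenalty μ g M Q + ε := by
  have : Nonempty (UpdatePolicy M) := nonempty_updatePolicy hM
  rw [← sub_le_iff_le_add]
  refine le_ciInf fun π => ?_
  rw [sub_le_iff_le_add]
  obtain ⟨π', Θ, hΘ, hage⟩ := h π
  have hbdd : BddBelow (Set.range fun π : UpdatePolicy M => expectedPenalty
      (Measure.infinitePi fun _ : ℕ => μ') (fun j y => y j) g Q' π) :=
    ⟨0, by rintro _ ⟨π, rfl⟩; exact integral_nonneg fun _ => hnonneg _⟩
  refine (ciInf_le hbdd π').trans ?_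
  have hm : Measurable fun p : (ℕ → ℝ) × (ℕ → unitInterval) => g (age π p.1 p.2 Q) :=
    hg.measurable.comp (measurable_age π hQ)
  -- The age never exceeds that of update `0`, namely `Q + Y₀ ≤ K`. This gives integrability and
  -- makes `hη` applicable.
  have hmem : ∀ᵐ p ∂((Measure.infinitePi fun _ : ℕ => μ).prod seedLaw),
      age π p.1 p.2 Q ∈ Set.Icc 0 K := by
    have h1 := Measure.quasiMeasurePreserving_fst (μ := Measure.infinitePi fun _ : ℕ => μ)
      (ν := seedLaw) |>.ae (ae_forall_of_infinitePi hμ)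
    filter_upwards [h1] with p hp
    refine ⟨age_nonneg π (fun j => (hp j).1) _ hQ, ?_⟩
    linarith [age_le_add π (fun j => (hp j).1) p.2 hQ, (hp 0).2]
  have hint : Integrable (fun p : (ℕ → ℝ) × (ℕ → unitInterval) => g (age π p.1 p.2 Q))
      ((Measure.infinitePi fun _ : ℕ => μ).prod seedLaw) := by
    refine Integrable.of_bound hm.aestronglyMeasurable (g K) ?_
    filter_upwards [hmem] with p hp
    rw [Real.norm_of_nonneg (hnonneg _)]
    exact hmono hp.2
  have hint' : Integrable (fun p => g (age π (Θ p).1 (Θ p).2 Q))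
      ((Measure.infinitePi fun _ : ℕ => μ').prod seedLaw) :=
    hΘ.integrable_comp_of_integrable hint
  have hrhs : expectedPenalty (Measure.infinitePi fun _ : ℕ => μ) (fun j y => y j) g Q π + ε =
      ∫ p, (g (age π (Θ p).1 (Θ p).2 Q) + ε)
        ∂((Measure.infinitePi fun _ : ℕ => μ').prod seedLaw) := by
    rw [integral_add hint' (integrable_const _)]
    simp only [integral_const, probReal_univ, one_smul]
    congr 1
    unfold expectedPenalty
    rw [← hΘ.map_eq, integral_map hΘ.aemeasurable hm.aestronglyMeasurable]
  rw [hrhs]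
  refine integral_mono_of_nonneg (.of_forall fun _ => hnonneg _)
    (hint'.add (integrable_const _)) ?_
  filter_upwards [hage, hΘ.quasiMeasurePreserving.ae hmem] with p hp hp'
  exact (hmono hp).trans (hη _ hp')

/-! ### Using the waiting periods of one system in another system -/

/-- Sampling the second components of a sequence of independent pairs, given the first ones. -/
lemma measurePreserving_sampling {κ : Measure (ℝ × ℝ)} [IsProbabilityMeasure κ]
    {φ : ℝ → unitInterval → ℝ} (hφ : Measurable (Function.uncurry φ))
    (h : (κ.fst.prod volume).map (fun p => (p.1, φ p.1 p.2)) = κ) :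
    MeasurePreserving (fun p : (ℕ → ℝ) × (ℕ → unitInterval) => fun i => (p.1 i, φ (p.1 i) (p.2 i)))
      ((Measure.infinitePi fun _ : ℕ => κ.fst).prod seedLaw)
      (Measure.infinitePi fun _ : ℕ => κ) := by
  have hm : Measurable fun p : ℝ × unitInterval => (p.1, φ p.1 p.2) := measurable_fst.prodMk hφ
  have h1 : MeasurePreserving (fun (p : (ℕ → ℝ) × (ℕ → unitInterval)) i => (p.1 i, p.2 i))
      ((Measure.infinitePi fun _ : ℕ => κ.fst).prod seedLaw)
      (Measure.infinitePi fun _ : ℕ => κ.fst.prod (volume : Measure unitInterval)) :=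
    ⟨by fun_prop, map_zip_infinitePi _ _⟩
  have h2 : MeasurePreserving (fun (x : ℕ → ℝ × unitInterval) i => ((x i).1, φ (x i).1 (x i).2))
      (Measure.infinitePi fun _ : ℕ => κ.fst.prod (volume : Measure unitInterval))
      (Measure.infinitePi fun _ : ℕ => κ) := by
    refine ⟨measurable_pi_iff.2 fun i => hm.comp (measurable_pi_apply i), ?_⟩
    rw [Measure.infinitePi_map_pi (μ := fun _ : ℕ => κ.fst.prod (volume : Measure unitInterval))
      (f := fun _ p => (p.1, φ p.1 p.2)) (fun _ => hm)]
    simp_rw [h]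
  exact h2.comp h1

lemma abs_delivery_sub_le (π π' : UpdatePolicy M) {a b : ℕ → ℝ} {u u' : ℕ → unitInterval} {q : ℝ}
    (hw : ∀ j, waiting π' b u' j = waiting π a u j) (hab : ∀ j, |b j - a j| ≤ q) (j : ℕ) :
    |delivery π' b u' j - delivery π a u j| ≤ j * q := by
  induction j with
  | zero => simp [delivery]
  | succ j ih =>
    have h := hab (j + 1)
    rw [abs_le] at ih h ⊢
    simp only [delivery, hw]
    push_cast
    constructor <;> linarith

/-- The summand `1` is needed for update `0`, whose request time `-Y₀` is already off by up to `q`.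
-/
lemma abs_request_sub_le (π π' : UpdatePolicy M) {a b : ℕ → ℝ} {u u' : ℕ → unitInterval} {q : ℝ}
    (hw : ∀ j, waiting π' b u' j = waiting π a u j) (hab : ∀ j, |b j - a j| ≤ q) (j : ℕ) :
    |request π' b u' j - request π a u j| ≤ (j + 1) * q := by
  have hq : 0 ≤ q := (abs_nonneg _).trans (hab 0)
  cases j with
  | zero =>
    have h := hab 0
    rw [abs_sub_comm] at h
    simpa [request, neg_add_eq_sub] using h
  | succ j =>
    have h := abs_delivery_sub_le π π' hw hab j
    simp only [request, hw, add_sub_add_right_eq_sub]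
    push_cast
    linarith

lemma delivery_le_delivery (π π' : UpdatePolicy M) {a b : ℕ → ℝ} {u u' : ℕ → unitInterval}
    (hw : ∀ j, waiting π' b u' j = waiting π a u j) (hab : ∀ j, b j ≤ a j) (j : ℕ) :
    delivery π' b u' j ≤ delivery π a u j := by
  induction j with
  | zero => simp [delivery]
  | succ j ih =>
    simp only [delivery, hw]
    linarith [hab (j + 1)]

/-- Update `j` is matched with update `j`. Delays of at least `c` force `j ≤ Q / c` for updates
delivered by `Q`, which bounds the accumulated error. The match is delivered in time either because
all its delays are shorter or because the query `Q'` is late enough to absorb the error. -/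
lemma age_le_of_waiting_eq (π π' : UpdatePolicy M) {a b : ℕ → ℝ} {u u' : ℕ → unitInterval}
    {q c Q Q' η : ℝ} (hc : 0 < c) (hQ : 0 ≤ Q)
    (hw : ∀ j, waiting π' b u' j = waiting π a u j) (hab : ∀ j, |b j - a j| ≤ q)
    (ha : ∀ j, c ≤ a j) (hb : ∀ j, 0 ≤ b j)
    (hlate : (Q' = Q ∧ ∀ j, b j ≤ a j) ∨ Q + (Q / c + 1) * q ≤ Q')
    (hη : Q' - Q + (Q / c + 1) * q ≤ η) :
    age π' b u' Q' ≤ age π a u Q + η := by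
  have hq : 0 ≤ q := (abs_nonneg _).trans (hab 0)
  refine age_le_age_add π π' hb hQ fun j hj => ⟨j, ?_, ?_⟩
  all_goals
    have hjc : (j : ℝ) ≤ Q / c := by
      rw [le_div_iff₀ hc]
      exact (mul_le_delivery π ha u j).trans hj
  · rcases hlate with ⟨rfl, hle⟩ | hlate
    · exact (delivery_le_delivery π π' hw hle j).trans hj
    · have h1 := (abs_le.1 (abs_delivery_sub_le π π' hw hab j)).2
      have h2 : (j : ℝ) * q ≤ (Q / c + 1) * q := by gcongr; linarith
      linarith
  · have h1 := (abs_le.1 (abs_request_sub_le π π' hw hab j)).1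
    have h2 : ((j : ℝ) + 1) * q ≤ (Q / c + 1) * q := by gcongr
    linarith

/-- Comparison of two systems with independent pairs of close delays: the system with delays
`p.1` samples the delays `p.2` of the other one and uses its waiting periods. -/
lemma lawPenalty_fst_le (hM : 0 ≤ M) {κ : Measure (ℝ × ℝ)} [IsProbabilityMeasure κ]
    {g : ℝ → ℝ} (hg : Continuous g) (hmono : Monotone g) (hnonneg : ∀ x, 0 ≤ g x)
    {q c C K Q Q' η ε : ℝ} (hc : 0 < c) (hQ : 0 ≤ Q)
    (hκ : ∀ᵐ p ∂κ, 0 ≤ p.1 ∧ p.2 ∈ Set.Icc c C ∧ |p.1 - p.2| ≤ q)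
    (hlate : (Q' = Q ∧ ∀ᵐ p ∂κ, p.1 ≤ p.2) ∨ Q + (Q / c + 1) * q ≤ Q')
    (hη : Q' - Q + (Q / c + 1) * q ≤ η) (hK : Q + C ≤ K)
    (hgη : ∀ x ∈ Set.Icc 0 K, g (x + η) ≤ g x + ε) :
    lawPenalty κ.fst g M Q' ≤ lawPenalty κ.snd g M Q + ε := by
  obtain ⟨φ, hφ, hφκ⟩ := exists_sampling κ
  -- The seed is split into two independent ones: the first samples the delays, the second drives
  -- `π`.
  obtain ⟨θ, hθ⟩ := exists_measurePreserving_seedLaw (seedLaw.prod seedLaw)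
  have hsnd : ∀ᵐ x ∂κ.snd, x ∈ Set.Icc 0 C := by
    refine (ae_map_iff measurable_snd.aemeasurable (p := (· ∈ Set.Icc 0 C)) measurableSet_Icc).2 ?_
    filter_upwards [hκ] with p hp
    exact ⟨hc.le.trans hp.2.1.1, hp.2.1.2⟩
  refine lawPenalty_le_add hM hg hmono hnonneg hQ hsnd hK hgη fun π => ?_
  have hφm : Measurable fun p : (ℕ → ℝ) × (ℕ → unitInterval) => fun i => φ (p.1 i) (p.2 i) :=
    measurable_pi_iff.2 fun i => hφ.comp (by fun_prop :
      Measurable fun p : (ℕ → ℝ) × (ℕ → unitInterval) => (p.1 i, p.2 i))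
  let W : ℕ → (ℕ → ℝ) → (ℕ → unitInterval) × (ℕ → unitInterval) → ℝ := fun j b s =>
    waiting π (fun i => φ (b i) (s.1 i)) s.2 j
  have hW : ∀ j, Measurable (fun p : (ℕ → ℝ) × _ => W j p.1 p.2) := fun j =>
    (measurable_waiting π j).comp ((hφm.comp (measurable_fst.prodMk
      (measurable_fst.comp measurable_snd))).prodMk (measurable_snd.comp measurable_snd))
  -- Sampling is done term by term, so the imagined history up to `j` needs only the observed one up
  -- to `j`.
  have hadapt : AdaptedRule W := fun j y y' s h =>
    waiting_congr π _ fun i hi => by rw [h i hi]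
  let Wt : UpdatePolicy M := UpdatePolicy.ofRule hM W hW θ hθ.measurable
  have hw : ∀ b u j, waiting Wt b u j = waiting π (fun i => φ (b i) ((θ u).1 i)) (θ u).2 j := by
    intro b u j
    rw [waiting_ofRule hM hW hθ.measurable hadapt, min_eq_right (waiting_mem _ _ _ _).2,
      max_eq_right (waiting_mem _ _ _ _).1]
  have hpair := measurePreserving_sampling hφ hφκ
  have hsplit : MeasurePreserving
      (fun p : (ℕ → ℝ) × (ℕ → unitInterval) => ((p.1, (θ p.2).1), (θ p.2).2))
      ((Measure.infinitePi fun _ : ℕ => κ.fst).prod seedLaw)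
      (((Measure.infinitePi fun _ : ℕ => κ.fst).prod seedLaw).prod seedLaw) :=
    (measurePreserving_prodAssoc _ _ _).symm.comp ((MeasurePreserving.id _).prod hθ)
  have hmap : MeasurePreserving (fun (x : ℕ → ℝ × ℝ) i => (x i).2)
      (Measure.infinitePi fun _ : ℕ => κ) (Measure.infinitePi fun _ : ℕ => κ.snd) :=
    ⟨by fun_prop, Measure.infinitePi_map_pi (μ := fun _ : ℕ => κ) (fun _ => measurable_snd)⟩
  refine ⟨Wt, fun p => (fun i => φ (p.1 i) ((θ p.2).1 i), (θ p.2).2),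
    ((hmap.comp hpair).prod (MeasurePreserving.id _)).comp hsplit, ?_⟩
  have hproj : MeasurePreserving
      (fun p : (ℕ → ℝ) × (ℕ → unitInterval) => fun i => (p.1 i, φ (p.1 i) ((θ p.2).1 i)))
      ((Measure.infinitePi fun _ : ℕ => κ.fst).prod seedLaw)
      (Measure.infinitePi fun _ : ℕ => κ) :=
    hpair.comp (measurePreserving_fst.comp hsplit)
  have hlate' : ∀ᵐ p ∂((Measure.infinitePi fun _ : ℕ => κ.fst).prod seedLaw),
      (Q' = Q ∧ ∀ j, p.1 j ≤ φ (p.1 j) ((θ p.2).1 j)) ∨ Q + (Q / c + 1) * q ≤ Q' := by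
    rcases hlate with ⟨h1, h2⟩ | h
    · filter_upwards [hproj.quasiMeasurePreserving.ae (ae_forall_of_infinitePi h2)] with p hp
      exact .inl ⟨h1, hp⟩
    · exact .of_forall fun _ => .inr h
  filter_upwards [hlate', hproj.quasiMeasurePreserving.ae (ae_forall_of_infinitePi hκ)]
    with p hp1 hp2
  exact age_le_of_waiting_eq π Wt hc hQ (hw p.1 p.2) (fun j => (hp2 j).2.2)
    (fun j => (hp2 j).2.1.1) (fun j => (hp2 j).1) hp1 hη

/-! ### Advancing the query

For i.i.d. delays, a policy for the query at `Q` is turned into a policy for the query at `Q - δ`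
which is at least as good.  If the first waiting period is at least `δ`, it is shortened by `δ`.
Otherwise, a delay `x` is sampled for update `1`; the time until the request of update `2` is
spent waiting if it is short, and else is filled by an actual update. -/

/-- Insert `x` as second term. -/
def insertSecond (x : ℝ) (y : ℕ → ℝ) : ℕ → ℝ
  | 0 => y 0
  | 1 => x
  | n + 2 => y (n + 1)

/-- Replace the second term by `x`. -/
def replaceSecond (x : ℝ) (y : ℕ → ℝ) : ℕ → ℝ
  | 0 => y 0
  | 1 => x
  | n + 2 => y (n + 2)

lemma measurable_insertSecond :
    Measurable fun p : ℝ × (ℕ → ℝ) => insertSecond p.1 p.2 := by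
  refine measurable_pi_iff.2 fun i => ?_
  rcases i with _ | _ | n <;> simp only [insertSecond] <;> fun_prop

lemma measurable_replaceSecond :
    Measurable fun p : ℝ × (ℕ → ℝ) => replaceSecond p.1 p.2 := by
  refine measurable_pi_iff.2 fun i => ?_
  rcases i with _ | _ | n <;> simp only [replaceSecond] <;> fun_prop

/-- The first waiting period, as a function of the delay of update `0`. -/
noncomputable def firstWait (π : UpdatePolicy M) (y₀ : ℝ) (v : ℕ → unitInterval) : ℝ :=
  waiting π (fun _ => y₀) v 0

/-- The request time of update `2`, reduced by `δ`, if `y₀` and `x` are the delays of updates `0`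
and `1`. -/
noncomputable def advancedRequest (π : UpdatePolicy M) (δ y₀ x : ℝ) (v : ℕ → unitInterval) : ℝ :=
  firstWait π y₀ v + x + waiting π (insertSecond x fun _ => y₀) v 1 - δ

lemma waiting_zero_eq (π : UpdatePolicy M) (y : ℕ → ℝ) (v : ℕ → unitInterval) :
    waiting π y v 0 = firstWait π (y 0) v :=
  waiting_congr π v fun i hi => by rw [Nat.le_zero.1 hi]

lemma request_two_eq (π : UpdatePolicy M) (δ : ℝ) (y : ℕ → ℝ) (v : ℕ → unitInterval) :
    request π y v 2 = advancedRequest π δ (y 0) (y 1) v + δ := by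
  have h : waiting π y v 1 = waiting π (insertSecond (y 1) fun _ => y 0) v 1 :=
    waiting_congr π v fun i hi => by
      interval_cases i <;> rfl
  simp only [request, delivery, advancedRequest, waiting_zero_eq, h]
  ring

open Classical in
/-- The delays fed to the original policy. -/
noncomputable def advancedDelays (π : UpdatePolicy M) (δ B : ℝ) (y : ℕ → ℝ)
    (s : ℝ × (ℕ → unitInterval)) : ℕ → ℝ :=
  if δ ≤ firstWait π (y 0) s.2 then y
  else if advancedRequest π δ (y 0) s.1 s.2 ≤ B then insertSecond s.1 y
  else replaceSecond s.1 y

open Classical in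
/-- The waiting periods of the policy for the advanced query. -/
noncomputable def advancedRule (π : UpdatePolicy M) (δ B Q : ℝ) :
    ℕ → (ℕ → ℝ) → ℝ × (ℕ → unitInterval) → ℝ
  | 0, y, s =>
    if δ ≤ firstWait π (y 0) s.2 then firstWait π (y 0) s.2 - δ
    else if advancedRequest π δ (y 0) s.1 s.2 ≤ B then advancedRequest π δ (y 0) s.1 s.2
    -- A filler update requested `B` before this minimum is back both before the next planned
    -- request and before the advanced query. The next waiting period then lasts exactly until the
    -- planned request.
    else min (advancedRequest π δ (y 0) s.1 s.2) (Q - δ) - B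
  | 1, y, s =>
    if δ ≤ firstWait π (y 0) s.2 then waiting π y s.2 1
    else if advancedRequest π δ (y 0) s.1 s.2 ≤ B then waiting π (insertSecond s.1 y) s.2 2
    else advancedRequest π δ (y 0) s.1 s.2 -
      (min (advancedRequest π δ (y 0) s.1 s.2) (Q - δ) - B) - y 1
  | n + 2, y, s =>
    if δ ≤ firstWait π (y 0) s.2 then waiting π y s.2 (n + 2)
    else if advancedRequest π δ (y 0) s.1 s.2 ≤ B then waiting π (insertSecond s.1 y) s.2 (n + 3)
    else waiting π (replaceSecond s.1 y) s.2 (n + 2)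

lemma measurable_firstWait (π : UpdatePolicy M) :
    Measurable fun p : ℝ × (ℕ → unitInterval) => firstWait π p.1 p.2 :=
  (measurable_waiting π 0).comp
    ((measurable_pi_iff.2 fun _ => measurable_fst).prodMk measurable_snd)

lemma measurable_advancedRequest (π : UpdatePolicy M) (δ : ℝ) :
    Measurable fun p : ℝ × ℝ × (ℕ → unitInterval) => advancedRequest π δ p.1 p.2.1 p.2.2 := by
  have h1 : Measurable fun p : ℝ × ℝ × (ℕ → unitInterval) => firstWait π p.1 p.2.2 :=
    (measurable_firstWait π).comp (by fun_prop :
      Measurable fun p : ℝ × ℝ × (ℕ → unitInterval) => (p.1, p.2.2))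
  have h2 : Measurable fun p : ℝ × ℝ × (ℕ → unitInterval) => insertSecond p.2.1 fun _ => p.1 :=
    measurable_insertSecond.comp (by fun_prop :
      Measurable fun p : ℝ × ℝ × (ℕ → unitInterval) => (p.2.1, fun _ : ℕ => p.1))
  have h3 : Measurable fun p : ℝ × ℝ × (ℕ → unitInterval) =>
      waiting π (insertSecond p.2.1 fun _ => p.1) p.2.2 1 :=
    (measurable_waiting π 1).comp (h2.prodMk (by fun_prop))
  unfold advancedRequest
  fun_prop

section Measurability

variable (π : UpdatePolicy M) (δ B Q : ℝ)

lemma measurable_firstWait_apply : Measurable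
    fun p : (ℕ → ℝ) × ℝ × (ℕ → unitInterval) => firstWait π (p.1 0) p.2.2 :=
  (measurable_firstWait π).comp (by fun_prop :
    Measurable fun p : (ℕ → ℝ) × ℝ × (ℕ → unitInterval) => (p.1 0, p.2.2))

lemma measurable_advancedRequest_apply : Measurable
    fun p : (ℕ → ℝ) × ℝ × (ℕ → unitInterval) => advancedRequest π δ (p.1 0) p.2.1 p.2.2 :=
  (measurable_advancedRequest π δ).comp (by fun_prop :
    Measurable fun p : (ℕ → ℝ) × ℝ × (ℕ → unitInterval) => (p.1 0, p.2.1, p.2.2))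

lemma measurable_insertSecond_apply : Measurable
    fun p : (ℕ → ℝ) × ℝ × (ℕ → unitInterval) => insertSecond p.2.1 p.1 :=
  measurable_insertSecond.comp (by fun_prop :
    Measurable fun p : (ℕ → ℝ) × ℝ × (ℕ → unitInterval) => (p.2.1, p.1))

lemma measurable_replaceSecond_apply : Measurable
    fun p : (ℕ → ℝ) × ℝ × (ℕ → unitInterval) => replaceSecond p.2.1 p.1 :=
  measurable_replaceSecond.comp (by fun_prop :
    Measurable fun p : (ℕ → ℝ) × ℝ × (ℕ → unitInterval) => (p.2.1, p.1))

lemma measurable_advancedDelays :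
    Measurable fun p : (ℕ → ℝ) × ℝ × (ℕ → unitInterval) => advancedDelays π δ B p.1 p.2 :=
  Measurable.ite (measurableSet_le measurable_const (measurable_firstWait_apply π)) measurable_fst
    (Measurable.ite (measurableSet_le (measurable_advancedRequest_apply π δ) measurable_const)
      measurable_insertSecond_apply measurable_replaceSecond_apply)

lemma measurable_advancedRule (j : ℕ) :
    Measurable fun p : (ℕ → ℝ) × ℝ × (ℕ → unitInterval) => advancedRule π δ B Q j p.1 p.2 := by
  have h1 := measurable_firstWait_apply π
  have h2 := measurable_advancedRequest_apply π δ
  have hs1 := measurableSet_le (measurable_const (a := δ)) h1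
  have hs2 := measurableSet_le h2 (measurable_const (a := B))
  have hv : Measurable fun p : (ℕ → ℝ) × ℝ × (ℕ → unitInterval) => p.2.2 := by fun_prop
  have hw (k : ℕ) := (measurable_waiting π k).comp (measurable_fst.prodMk hv)
  have hi (k : ℕ) := (measurable_waiting π k).comp (measurable_insertSecond_apply.prodMk hv)
  have hr (k : ℕ) := (measurable_waiting π k).comp (measurable_replaceSecond_apply.prodMk hv)
  rcases j with _ | _ | n
  · exact Measurable.ite hs1 (by fun_prop) (Measurable.ite hs2 h2 (by fun_prop))
  · exact Measurable.ite hs1 (hw 1) (Measurable.ite hs2 (hi 2) (by fun_prop))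
  · exact Measurable.ite hs1 (hw (n + 2)) (Measurable.ite hs2 (hi (n + 3)) (hr (n + 2)))

lemma adaptedRule_advancedRule : AdaptedRule (advancedRule π δ B Q) := by
  intro j y y' s h
  have h0 : y 0 = y' 0 := h 0 (Nat.zero_le _)
  rcases j with _ | _ | n
  · simp only [advancedRule, h0]
  · have hw : waiting π y s.2 1 = waiting π y' s.2 1 := waiting_congr π _ h
    have hi : waiting π (insertSecond s.1 y) s.2 2 = waiting π (insertSecond s.1 y') s.2 2 :=
      waiting_congr π _ fun i hi => by
        rcases i with _ | _ | i <;> simp only [insertSecond, h0]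
        exact h _ (by omega)
    simp only [advancedRule, h0, hw, hi, h 1 le_rfl]
  · have hw : waiting π y s.2 (n + 2) = waiting π y' s.2 (n + 2) := waiting_congr π _ h
    have hi : waiting π (insertSecond s.1 y) s.2 (n + 3) =
        waiting π (insertSecond s.1 y') s.2 (n + 3) :=
      waiting_congr π _ fun i hi => by
        rcases i with _ | _ | i <;> simp only [insertSecond, h0]
        exact h _ (by omega)
    have hr : waiting π (replaceSecond s.1 y) s.2 (n + 2) =
        waiting π (replaceSecond s.1 y') s.2 (n + 2) :=
      waiting_congr π _ fun i hi => by
        rcases i with _ | _ | i <;> simp only [replaceSecond, h0]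
        exact h _ (by omega)
    simp only [advancedRule, h0, hw, hi, hr]

end Measurability

/-! ### The law of the delays fed to the original policy -/

/-- The choice between keeping, inserting and replacing depends only on `y 0`, the sampled delay and
the seed. These are independent of `y 1, y 2, …`, so keeping or dropping `y 1` leaves an i.i.d.
sequence independent of the seed. -/
lemma measurePreserving_advancedDelays (π : UpdatePolicy M) (δ B : ℝ) (μ : Measure ℝ)
    [IsProbabilityMeasure μ] :
    MeasurePreserving
      (fun p : (ℕ → ℝ) × ℝ × (ℕ → unitInterval) => (advancedDelays π δ B p.1 p.2, p.2.2))
      ((Measure.infinitePi fun _ : ℕ => μ).prod (μ.prod seedLaw))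
      ((Measure.infinitePi fun _ : ℕ => μ).prod seedLaw) := by
  classical
  set lam : Measure (ℕ → ℝ) := Measure.infinitePi fun _ : ℕ => μ with hlam
  have hcons : MeasurePreserving consSeq (μ.prod lam) lam := measurePreserving_consSeq μ
  have hshift : MeasurePreserving (fun (x : ℕ → ℝ) n => x (n + 1)) lam lam :=
    ⟨by fun_prop, map_succ_infinitePi μ⟩
  -- regroup the variables: the data known at time `0` come first
  have hregroup : MeasurePreserving
      (fun p : (ℝ × (ℕ → unitInterval)) × (ℝ × (ℕ → ℝ)) =>
        (consSeq (p.1.1, p.2.2), (p.2.1, p.1.2)))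
      ((μ.prod seedLaw).prod (μ.prod lam)) (lam.prod (μ.prod seedLaw)) := by
    have h1 : MeasurePreserving (fun q : (ℕ → unitInterval) × (ℝ × (ℕ → ℝ)) =>
        (q.2.2, (q.2.1, q.1))) (seedLaw.prod (μ.prod lam)) (lam.prod (μ.prod seedLaw)) :=
      ((MeasurePreserving.id lam).prod Measure.measurePreserving_swap).comp
        (Measure.measurePreserving_swap.comp (measurePreserving_prodAssoc seedLaw μ lam).symm)
    exact (hcons.prod (MeasurePreserving.id (μ.prod seedLaw))).comp
      ((measurePreserving_prodAssoc μ lam (μ.prod seedLaw)).symm.comp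
        (((MeasurePreserving.id μ).prod h1).comp
          (measurePreserving_prodAssoc μ seedLaw (μ.prod lam))))
  have hregroup' : MeasurePreserving
      (fun p : (ℝ × (ℕ → unitInterval)) × (ℕ → ℝ) => (consSeq (p.1.1, p.2), p.1.2))
      ((μ.prod seedLaw).prod lam) (lam.prod seedLaw) :=
    (hcons.prod (MeasurePreserving.id seedLaw)).comp
      ((measurePreserving_prodAssoc μ lam seedLaw).symm.comp
        (((MeasurePreserving.id μ).prod Measure.measurePreserving_swap).comp
          (measurePreserving_prodAssoc μ seedLaw lam)))
  -- The tail, from index `1` on, of the delays fed to `π`, given `a = (y 0, seed)` and `b =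
  -- (sampled delay, tail of y)`. For fixed `a` it has the i.i.d. law, and a skew product assembles
  -- the cases.
  let G : ℝ × (ℕ → unitInterval) → ℝ × (ℕ → ℝ) → ℕ → ℝ := fun a b =>
    if δ ≤ firstWait π a.1 a.2 then b.2
    else consSeq (b.1, if advancedRequest π δ a.1 b.1 a.2 ≤ B then b.2 else fun n => b.2 (n + 1))
  have hcond : Measurable fun p : (ℝ × (ℕ → unitInterval)) × (ℝ × (ℕ → ℝ)) =>
      advancedRequest π δ p.1.1 p.2.1 p.1.2 :=
    (measurable_advancedRequest π δ).comp (by fun_prop :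
      Measurable fun p : (ℝ × (ℕ → unitInterval)) × (ℝ × (ℕ → ℝ)) => (p.1.1, p.2.1, p.1.2))
  have hin : Measurable fun p : (ℝ × (ℕ → unitInterval)) × (ℝ × (ℕ → ℝ)) =>
      if advancedRequest π δ p.1.1 p.2.1 p.1.2 ≤ B then p.2.2 else fun n => p.2.2 (n + 1) :=
    Measurable.ite (measurableSet_le hcond measurable_const) (by fun_prop) (by fun_prop)
  have hG : Measurable (Function.uncurry G) :=
    Measurable.ite (measurableSet_le measurable_const ((measurable_firstWait π).comp
      measurable_fst)) (by fun_prop)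
      (measurable_consSeq.comp ((measurable_fst.comp measurable_snd).prodMk hin))
  have hGmap : ∀ a, (μ.prod lam).map (G a) = lam := by
    intro a
    by_cases h : δ ≤ firstWait π a.1 a.2
    · simp only [G, h, if_true]
      exact measurePreserving_snd.map_eq
    · simp only [G, h, if_false]
      refine (hcons.comp ((MeasurePreserving.id μ).skew_product
        (g := fun x (z : ℕ → ℝ) => if advancedRequest π δ a.1 x a.2 ≤ B then z
          else fun n => z (n + 1)) (hin.comp measurable_prodMk_left) ?_)).map_eq
      refine .of_forall fun x => ?_
      by_cases hx : advancedRequest π δ a.1 x a.2 ≤ B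
      · simp only [hx, if_true]
        exact Measure.map_id
      · simp only [hx, if_false]
        exact hshift.map_eq
  have hskew := hregroup'.comp ((MeasurePreserving.id (μ.prod seedLaw)).skew_product hG
    (.of_forall hGmap))
  have hm : Measurable fun p : (ℕ → ℝ) × ℝ × (ℕ → unitInterval) =>
      (advancedDelays π δ B p.1 p.2, p.2.2) :=
    (measurable_advancedDelays π δ B).prodMk (by fun_prop)
  refine ⟨hm, ?_⟩
  rw [← hregroup.map_eq, Measure.map_map hm hregroup.measurable, ← hskew.map_eq]
  congr 1
  funext p
  simp only [Function.comp_apply, Prod.mk.injEq, id_eq, and_true]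
  have h0 : consSeq (p.1.1, p.2.2) 0 = p.1.1 := rfl
  funext n
  simp only [advancedDelays, G, h0]
  by_cases h1 : δ ≤ firstWait π p.1.1 p.1.2
  · simp only [h1, if_true]
  · by_cases h2 : advancedRequest π δ p.1.1 p.2.1 p.1.2 ≤ B <;>
      simp only [h1, h2, if_true, if_false] <;> rcases n with _ | _ | n <;> rfl

/-! ### Pathwise comparison -/

/-- The indices `m` and `m'` differ when the new policy skips an update of the original one. -/
lemma delivery_eq_sub (π π' : UpdatePolicy M) {a y : ℕ → ℝ} {u u' : ℕ → unitInterval} {δ : ℝ}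
    {m m' : ℕ} (h0 : delivery π' y u' m' = delivery π a u m - δ)
    (hw : ∀ n, waiting π' y u' (m' + n) = waiting π a u (m + n))
    (hy : ∀ n, y (m' + n + 1) = a (m + n + 1)) (n : ℕ) :
    delivery π' y u' (m' + n) = delivery π a u (m + n) - δ := by
  induction n with
  | zero => exact h0
  | succ n ih =>
    rw [← add_assoc, ← add_assoc]
    simp only [delivery, hw, hy, ih]
    ring

lemma request_eq_sub (π π' : UpdatePolicy M) {a y : ℕ → ℝ} {u u' : ℕ → unitInterval} {δ : ℝ}
    {m m' : ℕ} (h0 : delivery π' y u' m' = delivery π a u m - δ)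
    (hw : ∀ n, waiting π' y u' (m' + n) = waiting π a u (m + n))
    (hy : ∀ n, y (m' + n + 1) = a (m + n + 1)) (n : ℕ) :
    request π' y u' (m' + n + 1) = request π a u (m + n + 1) - δ := by
  simp only [request, hw, delivery_eq_sub π π' h0 hw hy n]
  ring

lemma request_le_delivery_of_le (π : UpdatePolicy M) {y : ℕ → ℝ} (hy : ∀ j, 0 ≤ y j)
    (u : ℕ → unitInterval) {i j : ℕ} (hij : i ≤ j) :
    request π y u i ≤ delivery π y u j := by
  induction hij with
  | refl => exact request_le_delivery π hy u i
  | @step j _ ih =>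
    simp only [delivery]
    linarith [hy (j + 1), (waiting_mem π y u j).1]

/-- Each update of the original system delivered by `Q` gets a counterpart delivered by `Q - δ` and
no older then. Later updates are shifted by exactly `δ`. An original update `1` requested before `δ`
is matched by any update requested at a nonnegative time and delivered by `Q - δ`. -/
lemma age_advanced_le (π π' : UpdatePolicy M) {δ B c Q : ℝ} {y : ℕ → ℝ}
    {s : ℝ × (ℕ → unitInterval)} {u : ℕ → unitInterval}
    (hw : ∀ j, waiting π' y u j = max 0 (min M (advancedRule π δ B Q j y s)))
    (hy : ∀ j, y j ∈ Set.Icc c B) (hx : s.1 ∈ Set.Icc c B) (hBM : B ≤ M) (hδ : 0 < δ)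
    (hδc : δ ≤ c) (hQ : 2 * B + δ ≤ Q) :
    age π' y u (Q - δ) ≤ age π (advancedDelays π δ B y s) s.2 Q := by
  have hM : 0 ≤ M := (waiting_mem π y u 0).1.trans (waiting_mem π y u 0).2
  have hB : 0 ≤ B := by linarith [(hy 0).1, (hy 0).2]
  have hy0 : ∀ j, 0 ≤ y j := fun j => by linarith [(hy j).1]
  have clip : ∀ z, z ∈ Set.Icc 0 M → max 0 (min M z) = z := fun z hz => by
    rw [min_eq_right hz.2, max_eq_right hz.1]
  have clipw : ∀ a k, max 0 (min M (waiting π a s.2 k)) = waiting π a s.2 k := fun a k =>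
    clip _ (waiting_mem _ _ _ _)
  rw [← add_zero (age π _ _ _)]
  refine age_le_age_add π π' hy0 (by linarith) ?_
  have hzero : delivery π' y u 0 ≤ Q - δ := by simp only [delivery]; linarith
  by_cases h1 : δ ≤ firstWait π (y 0) s.2
  · have ha : advancedDelays π δ B y s = y := if_pos h1
    rw [ha]
    have hw0 : waiting π' y u 0 = waiting π y s.2 0 - δ := by
      rw [hw, waiting_zero_eq]
      simp only [advancedRule, h1, if_true]
      refine clip _ ⟨by linarith, ?_⟩
      have := (waiting_mem π (fun _ => y 0) s.2 0).2
      unfold firstWait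
      linarith
    have hwn : ∀ n, waiting π' y u (1 + n) = waiting π y s.2 (1 + n) := by
      intro n
      rw [hw, add_comm]
      rcases n with _ | n <;> simp only [advancedRule, h1, if_true] <;> exact clipw _ _
    have hD : delivery π' y u 1 = delivery π y s.2 1 - δ := by
      simp only [delivery, hw0]; ring
    intro j hj
    rcases j with _ | j
    · refine ⟨0, hzero, ?_⟩
      simp only [request]
      linarith
    · refine ⟨j + 1, ?_, ?_⟩
      · have := delivery_eq_sub π π' hD hwn (fun _ => rfl) j
        rw [add_comm j 1, this, add_comm 1 j]
        linarith
      · rcases j with _ | j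
        · simp only [request, delivery, hw0]; linarith
        · have := request_eq_sub π π' hD hwn (fun _ => rfl) j
          rw [add_comm j 1, this]
          linarith
  have hZ0 : 0 ≤ firstWait π (y 0) s.2 := (waiting_mem π (fun _ => y 0) s.2 0).1
  have hZ1 := waiting_mem π (insertSecond s.1 fun _ => y 0) s.2 1
  push Not at h1
  have hTdef : advancedRequest π δ (y 0) s.1 s.2 = firstWait π (y 0) s.2 + s.1 +
    waiting π (insertSecond s.1 fun _ => y 0) s.2 1 - δ := rfl
  set T := advancedRequest π δ (y 0) s.1 s.2 with hT
  -- Here `δ ≤ c` enters: the sampled delay alone already exceeds or equals the shift.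
  have hT0 : 0 ≤ T := by linarith [hZ1.1, hx.1]
  have hTM : T ≤ B + M := by linarith [hZ1.2, hx.2]
  by_cases h2 : T ≤ B
  · have ha : advancedDelays π δ B y s = insertSecond s.1 y := by
      rw [advancedDelays, if_neg h1.not_ge, if_pos h2]
    rw [ha]
    have hR2 : request π (insertSecond s.1 y) s.2 2 = T + δ :=
      request_two_eq π δ (insertSecond s.1 y) s.2
    have hw0 : waiting π' y u 0 = T := by
      rw [hw, advancedRule, if_neg h1.not_ge, if_pos h2]
      exact clip _ ⟨hT0, h2.trans hBM⟩
    have hwn : ∀ n, waiting π' y u (1 + n) = waiting π (insertSecond s.1 y) s.2 (2 + n) := by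
      intro n
      rw [hw, add_comm 1, add_comm 2]
      rcases n with _ | n <;>
      · rw [advancedRule, if_neg h1.not_ge, if_pos h2]
        exact clipw _ _
    have hyn : ∀ n, y (1 + n + 1) = insertSecond s.1 y (2 + n + 1) := by
      intro n
      rw [show 2 + n + 1 = (1 + n) + 2 by ring]
      rfl
    have hD : delivery π' y u 1 = delivery π (insertSecond s.1 y) s.2 2 - δ := by
      have : delivery π (insertSecond s.1 y) s.2 2 =
        request π (insertSecond s.1 y) s.2 2 + y 1 := rfl
      rw [this, hR2]
      simp only [delivery, hw0]; ring
    intro j hj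
    rcases j with _ | _ | j
    · refine ⟨0, hzero, ?_⟩
      simp only [request, insertSecond]
      linarith
    -- The new update `1` stands in for both original updates `1` and `2`. It arrives by `2 * B ≤ Q
    -- - δ`.
    · refine ⟨1, ?_, ?_⟩
      · simp only [delivery, hw0]
        linarith [(hy 1).2]
      · simp only [request, delivery, hw0, waiting_zero_eq, insertSecond]
        linarith
    · refine ⟨1 + j, ?_, ?_⟩
      · rw [delivery_eq_sub π π' hD hwn hyn j, add_comm 2 j]
        linarith
      · rcases j with _ | j
        · have : request π' y u 1 = T := by simp only [request, delivery, hw0]; ring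
          rw [add_zero, this, zero_add, hR2]
          linarith
        · rw [← add_assoc 1 j 1, request_eq_sub π π' hD hwn hyn j,
            show 2 + j + 1 = j + 1 + 2 by ring]
          linarith
  · have ha : advancedDelays π δ B y s = replaceSecond s.1 y := by
      rw [advancedDelays, if_neg h1.not_ge, if_neg h2]
    rw [ha]
    push Not at h2
    have hR2 : request π (replaceSecond s.1 y) s.2 2 = T + δ :=
      request_two_eq π δ (replaceSecond s.1 y) s.2
    have hmin1 : min T (Q - δ) ≤ T := min_le_left _ _
    have hmin2 : min T (Q - δ) ≤ Q - δ := min_le_right _ _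
    have hmin3 : B ≤ min T (Q - δ) := le_min h2.le (by linarith)
    have hw0 : waiting π' y u 0 = min T (Q - δ) - B := by
      rw [hw, advancedRule, if_neg h1.not_ge, if_neg h2.not_ge]
      exact clip _ ⟨by linarith, by linarith⟩
    have ha0 : ∀ j, 0 ≤ replaceSecond s.1 y j := by
      intro j
      rcases j with _ | _ | j
      · exact hy0 0
      · exact hδ.le.trans (hδc.trans hx.1)
      · exact hy0 _
    intro j hj
    rcases j with _ | _ | j
    · refine ⟨0, hzero, ?_⟩
      simp only [request, replaceSecond]
      linarith
    · refine ⟨1, ?_, ?_⟩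
      · simp only [delivery, hw0]
        linarith [(hy 1).2]
      · simp only [request, delivery, hw0, waiting_zero_eq, replaceSecond]
        linarith
    -- An update of index at least `2` delivered by `Q` forces the original request `T + δ` of
    -- update `2` to be at most `Q`, so the minimum is `T`.
    · have hTQ : T ≤ Q - δ := by
        have := request_le_delivery_of_le π ha0 s.2 (Nat.le_add_left 2 j)
        linarith
      rw [min_eq_left hTQ] at hw0
      have hw1 : waiting π' y u 1 = B - y 1 := by
        rw [hw, advancedRule, if_neg h1.not_ge, if_neg h2.not_ge, ← hT, min_eq_left hTQ,
          show T - (T - B) - y 1 = B - y 1 by ring]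
        exact clip _ ⟨by linarith [(hy 1).2], by linarith [hy0 1]⟩
      have hwn : ∀ n, waiting π' y u (2 + n) = waiting π (replaceSecond s.1 y) s.2 (2 + n) := by
        intro n
        rw [hw, add_comm 2, advancedRule, if_neg h1.not_ge, if_neg h2.not_ge]
        exact clipw _ _
      have hyn : ∀ n, y (2 + n + 1) = replaceSecond s.1 y (2 + n + 1) := by
        intro n
        rw [show 2 + n + 1 = (n + 1) + 2 by ring]
        rfl
      have hR : request π' y u 2 = T := by simp only [request, delivery, hw0, hw1]; ring
      have hD : delivery π' y u 2 = delivery π (replaceSecond s.1 y) s.2 2 - δ := by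
        have e1 : delivery π (replaceSecond s.1 y) s.2 2 =
          request π (replaceSecond s.1 y) s.2 2 + y 2 := rfl
        have e2 : delivery π' y u 2 = request π' y u 2 + y 2 := rfl
        rw [e1, e2, hR2, hR]; ring
      refine ⟨2 + j, ?_, ?_⟩
      · rw [delivery_eq_sub π π' hD hwn hyn j, add_comm 2 j]
        linarith
      · rcases j with _ | j
        · rw [add_zero, hR, zero_add, hR2]
          linarith
        · rw [← add_assoc 2 j 1, request_eq_sub π π' hD hwn hyn j,
            show 2 + j + 1 = j + 1 + 2 by ring]
          linarith

/-- For i.i.d. delays, the optimal penalty does not increase if the query is advanced slightly. -/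
lemma lawPenalty_sub_le {μ : Measure ℝ} [IsProbabilityMeasure μ] {g : ℝ → ℝ} (hg : Continuous g)
    (hmono : Monotone g) (hnonneg : ∀ x, 0 ≤ g x) {δ B c Q : ℝ}
    (hμ : ∀ᵐ x ∂μ, x ∈ Set.Icc c B) (hBM : B ≤ M) (hδ : 0 < δ) (hδc : δ ≤ c) (hB : 0 ≤ B)
    (hQ : 2 * B + δ ≤ Q) :
    lawPenalty μ g M (Q - δ) ≤ lawPenalty μ g M Q := by
  have hM : 0 ≤ M := hB.trans hBM
  have hμ0 : ∀ᵐ x ∂μ, x ∈ Set.Icc 0 B := by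
    filter_upwards [hμ] with x hx
    exact ⟨by linarith [hx.1], hx.2⟩
  obtain ⟨θ, hθ⟩ := exists_measurePreserving_seedLaw (μ.prod seedLaw)
  rw [← add_zero (lawPenalty μ g M Q)]
  refine lawPenalty_le_add hM hg hmono hnonneg (by linarith) hμ0 le_rfl
    (η := 0) (fun x _ => by simp) fun π => ?_
  refine ⟨UpdatePolicy.ofRule hM _ (measurable_advancedRule π δ B Q) θ hθ.measurable, _,
    (measurePreserving_advancedDelays π δ B μ).comp ((MeasurePreserving.id _).prod hθ), ?_⟩
  have h1 := Measure.quasiMeasurePreserving_fst (μ := Measure.infinitePi fun _ : ℕ => μ)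
    (ν := seedLaw) |>.ae (ae_forall_of_infinitePi hμ)
  have h2 : MeasurePreserving (fun p : (ℕ → ℝ) × (ℕ → unitInterval) => (θ p.2).1)
      ((Measure.infinitePi fun _ : ℕ => μ).prod seedLaw) μ :=
    measurePreserving_fst.comp (hθ.comp measurePreserving_snd)
  filter_upwards [h1, h2.quasiMeasurePreserving.ae hμ] with p hp hp2
  rw [add_zero]
  exact age_advanced_le π _ (fun j => waiting_ofRule hM (measurable_advancedRule π δ B Q)
    hθ.measurable (adaptedRule_advancedRule π δ B Q) p.1 p.2 j) hp hp2 hBM hδ hδc hQ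

/-! ### Functions of common delays and quantization -/

lemma lawPenalty_map_le (hM : 0 ≤ M) {μ : Measure ℝ} [IsProbabilityMeasure μ] {f₁ f₂ : ℝ → ℝ}
    (hf₁ : Measurable f₁) (hf₂ : Measurable f₂)
    {g : ℝ → ℝ} (hg : Continuous g) (hmono : Monotone g) (hnonneg : ∀ x, 0 ≤ g x)
    {q c C K Q Q' η ε : ℝ} (hc : 0 < c) (hQ : 0 ≤ Q)
    (hμ : ∀ᵐ y ∂μ, 0 ≤ f₁ y ∧ f₂ y ∈ Set.Icc c C ∧ |f₁ y - f₂ y| ≤ q)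
    (hlate : (Q' = Q ∧ ∀ y, f₁ y ≤ f₂ y) ∨ Q + (Q / c + 1) * q ≤ Q')
    (hη : Q' - Q + (Q / c + 1) * q ≤ η) (hK : Q + C ≤ K)
    (hgη : ∀ x ∈ Set.Icc 0 K, g (x + η) ≤ g x + ε) :
    lawPenalty (μ.map f₁) g M Q' ≤ lawPenalty (μ.map f₂) g M Q + ε := by
  have hm : Measurable fun y => (f₁ y, f₂ y) := hf₁.prodMk hf₂
  have : IsProbabilityMeasure (μ.map fun y => (f₁ y, f₂ y)) :=
    Measure.isProbabilityMeasure_map hm.aemeasurable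
  rw [← Measure.fst_map_prodMk (μ := μ) (X := f₁) hf₂,
    ← Measure.snd_map_prodMk (μ := μ) (Y := f₂) hf₁]
  refine lawPenalty_fst_le hM hg hmono hnonneg hc hQ ?_ ?_ hη hK hgη
  · refine (ae_map_iff hm.aemeasurable ?_).2 hμ
    exact (measurableSet_le measurable_const measurable_fst).inter
      ((measurable_snd measurableSet_Icc).inter (measurableSet_le
        (measurable_fst.sub measurable_snd).abs measurable_const))
  · refine hlate.imp_left fun h => ⟨h.1, ?_⟩
    exact (ae_map_iff hm.aemeasurable (measurableSet_le measurable_fst measurable_snd)).2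
      (.of_forall h.2)

/-- Ages are nonnegative almost surely, so `g` may be replaced by any measurable function that
agrees with it on the half-line. -/
lemma optimalPenalty_eq_lawPenalty {Ω : Type*} [MeasurableSpace Ω] {P : Measure Ω}
    [IsProbabilityMeasure P] {Y : ℕ → Ω → ℝ} (hY : ∀ j, Measurable (Y j)) (hind : iIndepFun Y P)
    (hident : ∀ j, IdentDistrib (Y j) (Y 0) P P) {f : ℝ → ℝ} (hf : Measurable f)
    (hnonneg : ∀ j, ∀ᵐ ω ∂P, 0 ≤ f (Y j ω)) {g g' : ℝ → ℝ} (hg' : Measurable g')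
    (hgg' : ∀ x, 0 ≤ x → g x = g' x) {Q : ℝ} (hQ : 0 ≤ Q) :
    optimalPenalty P (fun j ω => f (Y j ω)) g M Q =
      lawPenalty ((P.map (Y 0)).map f) g' M Q := by
  unfold lawPenalty optimalPenalty
  congr 1
  funext π
  rw [← expectedPenalty_eq_of_iIndepFun (P := P) (Y := fun j ω => f (Y j ω))
    (fun j => hf.comp (hY j)) (hind.comp (fun _ => f) fun _ => hf) (fun j => ?_) hg' hQ π]
  · unfold expectedPenalty
    refine integral_congr_ae ?_
    have h := Measure.quasiMeasurePreserving_fst (μ := P) (ν := seedLaw) |>.ae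
      (ae_all_iff.2 hnonneg)
    filter_upwards [h] with p hp
    exact hgg' _ (age_nonneg π hp p.2 hQ)
  · rw [← (hident j).map_eq, Measure.map_map hf (hY j)]
    rfl

lemma exists_forall_add_le {g : ℝ → ℝ} (hg : Continuous g) (K : ℝ) {ε : ℝ} (hε : 0 < ε) :
    ∃ η, 0 < η ∧ ∀ x ∈ Set.Icc 0 K, g (x + η) ≤ g x + ε := by
  obtain ⟨d, hd, h⟩ := Metric.uniformContinuousOn_iff.1
    ((isCompact_Icc (a := (0 : ℝ)) (b := K + 1)).uniformContinuousOn_of_continuous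
      hg.continuousOn) ε hε
  -- The cap `1` keeps `x + η` inside the compact interval up to `K + 1`.
  refine ⟨min (d / 2) 1, by positivity, fun x hx => ?_⟩
  have hη : 0 < min (d / 2) 1 := by positivity
  have h1 := min_le_left (d / 2) 1
  have h2 := min_le_right (d / 2) 1
  have := h (x + min (d / 2) 1) ⟨by linarith [hx.1], by linarith [hx.2]⟩ x
    ⟨hx.1, by linarith [hx.2]⟩ (by
      rw [Real.dist_eq, add_sub_cancel_left, abs_of_pos hη]; linarith)
  rw [Real.dist_eq] at this
  linarith [(abs_lt.1 this).2]

lemma le_mul_ceil {q : ℝ} (hq : 0 < q) (y : ℝ) : y ≤ q * ⌈y / q⌉ := by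
  have := Int.le_ceil (y / q)
  rwa [div_le_iff₀' hq] at this

lemma mul_floor_le {q : ℝ} (hq : 0 < q) (y : ℝ) : q * ⌊y / q⌋ ≤ y := by
  have := Int.floor_le (y / q)
  rwa [le_div_iff₀' hq] at this

lemma mul_ceil_le {q : ℝ} (hq : 0 < q) (y : ℝ) : q * ⌈y / q⌉ ≤ q * ⌊y / q⌋ + q := by
  have h : (⌈y / q⌉ : ℝ) ≤ ⌊y / q⌋ + 1 := by exact_mod_cast Int.ceil_le_floor_add_one (y / q)
  nlinarith

end PullOrWait

/-! ### The cycle of inequalities between the three optima -/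

theorem proposition8 {Ω : Type*} [MeasurableSpace Ω] (P : Measure Ω) [IsProbabilityMeasure P]
    (Y : ℕ → Ω → ℝ) (BL BU M Q : ℝ) (g : ℝ → ℝ)
    (hYmeas : ∀ j, Measurable (Y j))
    (hYindep : iIndepFun Y P)
    (hYident : ∀ j, IdentDistrib (Y j) (Y 0) P P)
    (hBL : 0 < BL)
    (hYmem : ∀ j, ∀ᵐ ω ∂P, Y j ω ∈ Set.Icc BL BU)
    (hM : BU ≤ M) (hQ : 3 * BU < Q)
    (hgcont : ContinuousOn g (Set.Ici 0))
    (hgmono : MonotoneOn g (Set.Ici 0))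
    (hgnonneg : ∀ x ∈ Set.Ici (0 : ℝ), 0 ≤ g x)
    (ε : ℝ) (hε : 0 < ε) :
    ∃ N₁ : ℕ, ∀ N : ℕ, N₁ ≤ N →
      |PullOrWait.optimalPenalty P (PullOrWait.upperQuantized Q N Y) g M Q
        - PullOrWait.optimalPenalty P (PullOrWait.lowerQuantized Q N Y) g M Q| < ε ∧
      |PullOrWait.optimalPenalty P (PullOrWait.upperQuantized Q N Y) g M Q
        - PullOrWait.optimalPenalty P Y g M Q| < ε ∧
      |PullOrWait.optimalPenalty P (PullOrWait.lowerQuantized Q N Y) g M Q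
        - PullOrWait.optimalPenalty P Y g M Q| < ε := by
  open PullOrWait in
  have hBLU : BL ≤ BU := by
    obtain ⟨ω, hω⟩ := (hYmem 0).exists
    exact hω.1.trans hω.2
  have hM0 : 0 ≤ M := by linarith
  have hQ0 : 0 < Q := by linarith
  set μ : Measure ℝ := P.map (Y 0) with hμdef
  have : IsProbabilityMeasure μ := Measure.isProbabilityMeasure_map (hYmeas 0).aemeasurable
  have hμ : ∀ᵐ y ∂μ, y ∈ Set.Icc BL BU :=
    (ae_map_iff (hYmeas 0).aemeasurable (p := (· ∈ Set.Icc BL BU)) measurableSet_Icc).2 (hYmem 0)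
  -- extend the penalty function to the line
  let g' : ℝ → ℝ := fun x => g (max 0 x)
  have hg'cont : Continuous g' :=
    hgcont.comp_continuous (by fun_prop) fun x => Set.mem_Ici.2 (le_max_left _ _)
  have hg'mono : Monotone g' := fun x y h =>
    hgmono (Set.mem_Ici.2 (le_max_left _ _)) (Set.mem_Ici.2 (le_max_left _ _)) (
      max_le_max_left 0 h)
  have hg'nonneg : ∀ x, 0 ≤ g' x := fun x => hgnonneg _ (Set.mem_Ici.2 (le_max_left _ _))
  have hgg' : ∀ x, 0 ≤ x → g x = g' x := fun x hx => by simp only [g', max_eq_right hx]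
  -- With a quantization step of at most `1`, all delays are at most `BU + 1`, so this bounds every
  -- age in play.
  obtain ⟨η, hη, hgη⟩ := exists_forall_add_le hg'cont (Q + (BU + 1)) (ε := ε / 4) (by linarith)
  -- A common lower bound for all three kinds of delays once the step is at most `BL / 2`.
  obtain ⟨c, hc⟩ : ∃ c, c = BL / 2 := ⟨_, rfl⟩
  have hc0 : 0 < c := by linarith
  -- The factor `1 / 2` is for the link from upper to low, where the age grows by the shift `δ` and
  -- by a timing error of at most `δ`.
  obtain ⟨δ, hδ, hδη, hδc⟩ : ∃ δ, 0 < δ ∧ δ ≤ η / 2 ∧ δ ≤ c :=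
    ⟨min (η / 2) c, by positivity, min_le_left _ _, min_le_right _ _⟩
  have hA : 0 < Q / c + 1 := by positivity
  obtain ⟨q₀, hq₀, hq₀δ, hq₀c, hq₀1⟩ :
      ∃ q₀, 0 < q₀ ∧ q₀ ≤ δ / (Q / c + 1) ∧ q₀ ≤ c ∧ q₀ ≤ 1 :=
    ⟨min (δ / (Q / c + 1)) (min c 1), by positivity, min_le_left _ _,
      (min_le_right _ _).trans (min_le_left _ _), (min_le_right _ _).trans (min_le_right _ _)⟩
  refine ⟨⌈Q / q₀⌉₊ + 1, fun N hN => ?_⟩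
  have hN0 : (0 : ℝ) < N := by
    have : 0 < N := by omega
    exact_mod_cast this
  obtain ⟨q, hq⟩ : ∃ q, q = Q / N := ⟨_, rfl⟩
  have hqpos : 0 < q := by rw [hq]; positivity
  have hqq₀ : q ≤ q₀ := by
    rw [hq, div_le_comm₀ hN0 hq₀]
    refine (Nat.le_ceil _).trans ?_
    exact_mod_cast (Nat.le_succ _).trans hN
  have hqδ : (Q / c + 1) * q ≤ δ := by
    rw [← le_div_iff₀' hA]
    exact hqq₀.trans hq₀δ
  have hqδ' : ((Q - δ) / c + 1) * q ≤ (Q / c + 1) * q := by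
    gcongr
    linarith
  let up : ℝ → ℝ := fun y => q * (⌈y / q⌉ : ℝ)
  let lo : ℝ → ℝ := fun y => q * (⌊y / q⌋ : ℝ)
  have hup : Measurable up := by fun_prop
  have hlo : Measurable lo := by fun_prop
  have hupy : ∀ y, y ≤ up y := le_mul_ceil hqpos
  have hloy : ∀ y, lo y ≤ y := mul_floor_le hqpos
  have huplo : ∀ y, up y ≤ lo y + q := mul_ceil_le hqpos
  have eqY : optimalPenalty P Y g M Q = lawPenalty (μ.map id) g' M Q :=
    optimalPenalty_eq_lawPenalty hYmeas hYindep hYident measurable_id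
      (fun j => (hYmem j).mono fun ω h => hBL.le.trans h.1) hg'cont.measurable hgg' hQ0.le
  have equp : optimalPenalty P (upperQuantized Q N Y) g M Q = lawPenalty (μ.map up) g' M Q := by
    have : upperQuantized Q N Y = fun j ω => up (Y j ω) := by
      simp only [up, hq]; rfl
    rw [this]
    exact optimalPenalty_eq_lawPenalty hYmeas hYindep hYident hup
      (fun j => (hYmem j).mono fun ω h => by linarith [h.1, hupy (Y j ω)])
      hg'cont.measurable hgg' hQ0.le
  have eqlo : optimalPenalty P (lowerQuantized Q N Y) g M Q = lawPenalty (μ.map lo) g' M Q := by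
    have : lowerQuantized Q N Y = fun j ω => lo (Y j ω) := by
      simp only [lo, hq]; rfl
    rw [this]
    exact optimalPenalty_eq_lawPenalty hYmeas hYindep hYident hlo
      (fun j => (hYmem j).mono fun ω h => by
        linarith [h.1, hupy (Y j ω), huplo (Y j ω)])
      hg'cont.measurable hgg' hQ0.le
  have : IsProbabilityMeasure (μ.map lo) := Measure.isProbabilityMeasure_map hlo.aemeasurable
  have h1 : lawPenalty (μ.map lo) g' M Q ≤ lawPenalty (μ.map id) g' M Q + ε / 4 := by
    refine lawPenalty_map_le hM0 hlo measurable_id hg'cont hg'mono hg'nonneg (q := q) (C := BU + 1)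
      hc0 hQ0.le ?_ (.inl ⟨rfl, hloy⟩) (by linarith) le_rfl hgη
    filter_upwards [hμ] with y hy
    have e1 := hupy y
    have e2 := hloy y
    have e3 := huplo y
    rw [id, abs_le]
    exact ⟨by linarith [hy.1], ⟨by linarith [hy.1], by linarith [hy.2]⟩, by linarith, by linarith⟩
  have h2 : lawPenalty (μ.map id) g' M Q ≤ lawPenalty (μ.map up) g' M Q + ε / 4 := by
    refine lawPenalty_map_le hM0 measurable_id hup hg'cont hg'mono hg'nonneg (q := q) (C := BU + 1)
      hc0 hQ0.le ?_ (.inl ⟨rfl, hupy⟩) (by linarith) le_rfl hgη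
    filter_upwards [hμ] with y hy
    have e1 := hupy y
    have e2 := hloy y
    have e3 := huplo y
    rw [id, abs_le]
    exact ⟨by linarith [hy.1], ⟨by linarith [hy.1], by linarith [hy.2]⟩, by linarith, by linarith⟩
  -- The only link in which the simulating system has the longer delays: its query comes `δ` after
  -- the simulated one, which covers the accumulated lateness.
  have h3 : lawPenalty (μ.map up) g' M Q ≤ lawPenalty (μ.map lo) g' M (Q - δ) + ε / 4 := by
    refine lawPenalty_map_le hM0 hup hlo hg'cont hg'mono hg'nonneg (q := q) (C := BU + 1)
      hc0 (by linarith) ?_ (.inr (by linarith)) (by linarith) (by linarith) hgη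
    filter_upwards [hμ] with y hy
    have e1 := hupy y
    have e2 := hloy y
    have e3 := huplo y
    rw [abs_le]
    exact ⟨by linarith [hy.1], ⟨by linarith [hy.1], by linarith [hy.2]⟩, by linarith, by linarith⟩
  have h4 : lawPenalty (μ.map lo) g' M (Q - δ) ≤ lawPenalty (μ.map lo) g' M Q := by
    refine lawPenalty_sub_le hg'cont hg'mono hg'nonneg (c := c) (B := BU) ?_ hM hδ hδc
      (by linarith) (by linarith)
    refine (ae_map_iff hlo.aemeasurable (p := (· ∈ Set.Icc c BU)) measurableSet_Icc).2 ?_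
    filter_upwards [hμ] with y hy
    have e1 := hupy y
    have e2 := hloy y
    have e3 := huplo y
    exact ⟨by linarith [hy.1], by linarith [hy.2]⟩
  rw [eqY, equp, eqlo]
  simp only [abs_lt]
  -- Going once around the cycle costs `3 * ε / 4`, so any two of the optima differ by less than
  -- `ε`.
  refine ⟨⟨?_, ?_⟩, ⟨?_, ?_⟩, ?_, ?_⟩ <;> linarith
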